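/- Consider a rack-aware storage system with $n=\bar n u$ nodes arranged in $\bar n$ racks of $u$ nodes. A file of $B>0$ symbols is stored so that each node stores $\alpha\ge 0$ symbols and any $k\le n$ nodes suffice to retrieve the file. A failed node is repaired by a replacement node at the same position, which connects to some $l$ surviving nodes of its own rack ($0\le l<u$; intra-rack transmission is free) and to some $\bar d$ other racks, each of which uploads $\beta\ge 0$ symbols computed from the data of all its nodes; the repair bandwidth is $\bar d\beta$. Put $\bar k=\lfloor k/u\rfloor$, $u_0=k-\bar k u$, $\tilde u_0=\min\{u_0,l\}$, and assume $\bar d<\bar k$. Every finite sequence of repairs gives an information flow graph from the file (source) through the original and replacement nodes, with capacity $\alpha$ for each node, $\beta$ for each helper rack of each repair, and $\infty$ for all other edges. Let $B^*(\alpha,\beta)$ be the minimum, over all these graphs and all data collectors connecting to $k$ nodes present at the end, of the minimum cut between source and collector (the maximum possible file size). The pair $(\alpha,\beta)$ lies on the tradeoff curve (parameters of MET-RRCs) if $B=B^*(\alpha,\beta)$ and, in the case $\bar d>0$, any $l+1$ nodes of one rack (such as a replacement node with its $l$ local helpers, all recoverable from the at most $l\alpha+\bar d\beta$ symbols used in a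 repair) hold $(l+1)\alpha$ symbols of information, i.e. in every information flow graph the minimum cut between the source and these nodes is at least $(l+1)\alpha$. The MET-MSRR point is the point of this curve that minimizes first $\alpha$ and then the repair bandwidth (for $\bar d=0$, where the bandwidth vanishes, then $\beta$); the MET-MBRR point is the one that minimizes first the repair bandwidth and then $\alpha$. Then: (a) If $0<\bar d<\bar k$, both points exist and are unique. The MET-MSRR point is $$\alpha=\beta=\frac{B}{\bar k l+\tilde u_0+(u-l)\bar d},$$ and the MET-MBRR point is $$\alpha=\bar d\beta=\frac{B}{\bar k l+\tilde u_0+\frac{(u-l)(\bar d+1)}{2}}.$$ (b) If $\bar d=0<\bar k$ and $l\ge 1$, the MET-MSRR point exists and is unique, and it is $\beta=0$, $\alpha=\dfrac{B}{\bar k l+\tilde u_0}$. -/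

import Mathlib

open scoped ENNReal

/-- The nodes of a rack-aware storage system: the pair `(e, g)` is the `g`-th of the `u` nodes of
the `e`-th of the `nbar` racks. -/
abbrev RackNode (nbar u : ℕ) : Type := Fin nbar × Fin u

/-- One node repair: the failed node, the `l` surviving nodes of the host rack and the `dbar`
helper racks outside the host rack to which its replacement connects. -/
structure RackRepair (nbar u dbar l : ℕ) where
  failed : RackNode nbar u
  localHelpers : Finset (Fin u)
  card_localHelpers : localHelpers.card = l
  failed_notMem : failed.2 ∉ localHelpers
  helperRacks : Finset (Fin nbar)
  card_helperRacks : helperRacks.card = dbar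
  host_notMem : failed.1 ∉ helperRacks

/-- The vertices of the information flow graph of a storage system after `T` successive repairs.
* `origIn x` is the in-vertex of the original node `x`;
* `newIn t` is the in-vertex of the replacement node created by the `t`-th repair;
* `out i x` is the out-vertex of the node that sits at position `x` after the first `i` repairs;
* `relay t e` is the place in rack `e` where the symbols that `e` uploads during the `t`-th repair
  are computed from the data of all nodes of `e`. -/
inductive FlowVertex (nbar u T : ℕ) : Type
  | source : FlowVertex nbar u T
  | origIn (x : RackNode nbar u) : FlowVertex nbar u T
  | newIn (t : Fin T) : FlowVertex nbar u T
  | out (i : Fin (T + 1)) (x : RackNode nbar u) : FlowVertex nbar u T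
  | relay (t : Fin T) (e : Fin nbar) : FlowVertex nbar u T
  | collector : FlowVertex nbar u T
  deriving DecidableEq, Fintype

open Classical in
/-- The capacity of the edge between two vertices of the information flow graph given by the
repairs `h 0, h 1, …` and a data collector connecting to the final nodes at the positions `K`
(`0` means that there is no edge). -/
noncomputable def flowCapacity {nbar u dbar l T : ℕ} (α β : ℝ)
    (h : Fin T → RackRepair nbar u dbar l) (K : Finset (RackNode nbar u)) :
    FlowVertex nbar u T → FlowVertex nbar u T → ℝ≥0∞
  -- the file is distributed to the original nodes
  | .source, .origIn _ => ⊤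
  -- each node, original or replacement, stores `α` symbols
  | .origIn x, .out i y => if i = 0 ∧ y = x then ENNReal.ofReal α else 0
  | .newIn t, .out i y => if i = t.succ ∧ y = (h t).failed then ENNReal.ofReal α else 0
  -- a repair leaves the other nodes unchanged
  | .out i x, .out j y =>
      if ∃ t : Fin T, i = t.castSucc ∧ j = t.succ ∧ x = y ∧ x ≠ (h t).failed then ⊤ else 0
  -- the local helper nodes transmit freely to the replacement node
  | .out i x, .newIn t =>
      if i = t.castSucc ∧ x.1 = (h t).failed.1 ∧ x.2 ∈ (h t).localHelpers then ⊤ else 0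
  -- the nodes of a helper rack cooperate freely, and the rack uploads `β` symbols
  | .out i x, .relay t e =>
      if i = t.castSucc ∧ x.1 = e ∧ e ∈ (h t).helperRacks then ⊤ else 0
  | .relay t e, .newIn s => if t = s ∧ e ∈ (h t).helperRacks then ENNReal.ofReal β else 0
  -- the data collector
  | .out i x, .collector => if i = Fin.last T ∧ x ∈ K then ⊤ else 0
  | _, _ => 0

/-- The minimum, over all cuts separating the source from the data collector, of the total capacity
of the edges from the source side to the collector side. -/
noncomputable def flowMinCut {nbar u dbar l T : ℕ} (α β : ℝ)
    (h : Fin T → RackRepair nbar u dbar l) (K : Finset (RackNode nbar u)) : ℝ≥0∞ :=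
  ⨅ (U : Finset (FlowVertex nbar u T)) (_ : FlowVertex.source ∈ U)
    (_ : FlowVertex.collector ∉ U), ∑ a ∈ U, ∑ b ∈ Uᶜ, flowCapacity α β h K a b

/-- The maximum possible file size `B*`: the least min-cut over all information flow graphs (any
finite sequence of repairs) and all data collectors connecting to `k` nodes. -/
noncomputable def maxFileSize (nbar u k dbar l : ℕ) (α β : ℝ) : ℝ≥0∞ :=
  ⨅ (T : ℕ) (h : Fin T → RackRepair nbar u dbar l) (K : Finset (RackNode nbar u))
    (_ : K.card = k), flowMinCut α β h K

/-- `(α, β)` lies on the tradeoff curve for files of size `B`, i.e. these are the parameters of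
MET-RRCs: the file size `B` attains the maximum `B*`; and, in case the repair of a node uses data
from outside its rack (`0 < dbar`), the `l + 1` nodes that can be recovered from the data used in a
repair (the replacement and its `l` local helpers, thus any `l + 1` nodes of one rack) hold
`(l + 1) α` symbols of information about the file. -/
def IsMETRRC (nbar u k dbar l : ℕ) (B α β : ℝ) : Prop :=
  0 ≤ α ∧ 0 ≤ β ∧ ENNReal.ofReal B = maxFileSize nbar u k dbar l α β ∧
    (0 < dbar → ∀ (T : ℕ) (h : Fin T → RackRepair nbar u dbar l) (K : Finset (RackNode nbar u))
      (e : Fin nbar), (∀ x ∈ K, x.1 = e) → K.card = l + 1 →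
        ENNReal.ofReal (((l : ℝ) + 1) * α) ≤ flowMinCut α β h K)

/-- The minimum storage point: first the storage `α`, then the repair bandwidth is minimized.
(For `dbar = 0` the bandwidth vanishes for every `β`, and `β` itself is minimized.) -/
def IsMETMSRR (nbar u k dbar l : ℕ) (B α β : ℝ) : Prop :=
  IsMETRRC nbar u k dbar l B α β ∧
    ∀ α' β' : ℝ, IsMETRRC nbar u k dbar l B α' β' → α < α' ∨ (α = α' ∧ β ≤ β')

/-- The minimum bandwidth point: first the repair bandwidth `dbar * β`, then the storage `α` is
minimized. -/
def IsMETMBRR (nbar u k dbar l : ℕ) (B α β : ℝ) : Prop :=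
  IsMETRRC nbar u k dbar l B α β ∧
    ∀ α' β' : ℝ, IsMETRRC nbar u k dbar l B α' β' →
      dbar * β < dbar * β' ∨ (dbar * β = dbar * β' ∧ α ≤ α')

/-! With $A=\bar k l+\tilde u_0$ and $m=u-l$, everything reduces to
$B^*(\alpha,\beta)=A\alpha+m\sum_{i<\bar d}\min\{\alpha,(\bar d-i)\beta\}$ (`maxFileSize_eq`).

Lower bound: fix a cut of finite value and follow in time the set $S$ of positions whose current
node is on the collector side. The potential `setCost` charges $\alpha$ for up to $l$ nodes per rack
and the terms of `extraCost` for the surplus. A repair raises it by at most what that repair adds to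
the cut: if the new in-vertex is on the collector side, so are its $l$ local helpers, and every
helper rack not entirely in $S$ uploads across the cut (`setCost_le_flowMinCut`). Among sets of $k$
nodes the potential is bounded below by its value when racks are filled one after the other
(`le_setCost`).

Upper bound: take the first $k$ nodes and repair the surplus ones rack by rack, using earlier racks
as helpers as far as possible; an explicit cut attains the bound (`exists_flowMinCut_le`).

The same estimates with $k=l+1$ turn the information condition into $\alpha\le\bar d\beta$
(`forall_le_flowMinCut_iff`). What remains is real optimization: bounding each minimum by $\alpha$,
respectively by $(\bar d-i)\beta$, gives the two extreme points, and strictness of these bounds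
gives uniqueness. -/

/-- The vertices of the information flow graph, as a disjoint union of the six kinds. -/
def FlowVertex.equivSum (nbar u T : ℕ) :
    FlowVertex nbar u T ≃ Unit ⊕ RackNode nbar u ⊕ Fin T ⊕ (Fin (T + 1) × RackNode nbar u) ⊕
      (Fin T × Fin nbar) ⊕ Unit where
  toFun
    | .source => .inl ()
    | .origIn x => .inr (.inl x)
    | .newIn t => .inr (.inr (.inl t))
    | .out i x => .inr (.inr (.inr (.inl (i, x))))
    | .relay t e => .inr (.inr (.inr (.inr (.inl (t, e)))))
    | .collector => .inr (.inr (.inr (.inr (.inr ()))))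
  invFun
    | .inl _ => .source
    | .inr (.inl x) => .origIn x
    | .inr (.inr (.inl t)) => .newIn t
    | .inr (.inr (.inr (.inl p))) => .out p.1 p.2
    | .inr (.inr (.inr (.inr (.inl p)))) => .relay p.1 p.2
    | .inr (.inr (.inr (.inr (.inr _)))) => .collector
  left_inv v := by cases v <;> rfl
  right_inv v := by
    rcases v with _ | _ | _ | ⟨_, _⟩ | ⟨_, _⟩ | _ <;> rfl

theorem FlowVertex.sum_univ {nbar u T : ℕ} {M : Type*} [AddCommMonoid M]
    (f : FlowVertex nbar u T → M) :
    ∑ v, f v = f .source + (∑ x, f (.origIn x) + (∑ t, f (.newIn t) +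
      (∑ i, ∑ x, f (.out i x) + (∑ t, ∑ e, f (.relay t e) + f .collector)))) := by
  rw [← (FlowVertex.equivSum nbar u T).symm.sum_comp]
  simp only [Fintype.sum_sum_type, Fintype.sum_prod_type, Finset.univ_unique,
    Finset.sum_singleton]
  rfl

/-! ### The value of a finite cut -/

section Cut

variable {nbar u dbar l T : ℕ} {α β : ℝ} {h : Fin T → RackRepair nbar u dbar l}
  {K : Finset (RackNode nbar u)} {U : Finset (FlowVertex nbar u T)}

open Classical in
/-- The value of a cut through which no edge of infinite capacity passes. -/
theorem sum_flowCapacity_eq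
    (hU : ∀ a ∈ U, ∀ b ∉ U, flowCapacity α β h K a b ≠ ⊤)
    (hin : ∀ x, FlowVertex.origIn x ∈ U) :
    ∑ a ∈ U, ∑ b ∈ Uᶜ, flowCapacity α β h K a b =
      (Finset.univ.filter fun x => FlowVertex.out 0 x ∉ U).card * ENNReal.ofReal α +
      ∑ t, (if FlowVertex.newIn t ∈ U then
          if FlowVertex.out t.succ (h t).failed ∉ U then ENNReal.ofReal α else 0
        else ((h t).helperRacks.filter fun e => FlowVertex.relay t e ∈ U).card *
          ENNReal.ofReal β) := by
  -- Capacities are set to zero off the cut, so the double sum can run over all pairs of vertices;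
  -- edges of capacity $0$ or $\infty$ then contribute nothing.
  set g : FlowVertex nbar u T → FlowVertex nbar u T → ℝ≥0∞ := fun a b =>
    if a ∈ U ∧ b ∉ U then flowCapacity α β h K a b else 0 with hg
  have h0 : ∀ a b, flowCapacity α β h K a b = 0 ∨ flowCapacity α β h K a b = ⊤ → g a b = 0 := by
    intro a b hab
    simp only [hg]
    split_ifs with hc
    · exact hab.resolve_right (hU a hc.1 b hc.2)
    · rfl
  have hite : ∀ (p : Prop) [Decidable p],
      (if p then (⊤ : ℝ≥0∞) else 0) = 0 ∨ (if p then (⊤ : ℝ≥0∞) else 0) = ⊤ := by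
    intro p _
    by_cases hp : p <;> simp [hp]
  have hsum : ∑ a ∈ U, ∑ b ∈ Uᶜ, flowCapacity α β h K a b = ∑ a, ∑ b, g a b := by
    simp only [hg, ite_and, ← Finset.mem_compl]
    simp only [Finset.sum_ite_mem, Finset.sum_ite_irrel, Finset.sum_const_zero, Finset.univ_inter]
  have hsource : ∀ b, g .source b = 0 := by
    rintro (_ | x | _ | _ | _ | _)
    · exact h0 _ _ (.inl rfl)
    · simp [hg, hin]
    all_goals exact h0 _ _ (.inl rfl)
  have hcollector : ∀ b, g .collector b = 0 := by
    rintro (_ | _ | _ | _ | _ | _) <;> exact h0 _ _ (.inl rfl)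
  have hout : ∀ i x b, g (.out i x) b = 0 := by
    rintro i x (_ | _ | _ | _ | _ | _)
    · exact h0 _ _ (.inl rfl)
    · exact h0 _ _ (.inl rfl)
    all_goals exact h0 _ _ (hite _)
  have horigIn : ∀ x i y, g (.origIn x) (.out i y) =
      if x = y then if 0 = i then
        if FlowVertex.out 0 x ∉ U then ENNReal.ofReal α else 0 else 0 else 0 := by
    intro x i y
    by_cases hx : x = y <;> by_cases hi : 0 = i
    · subst hx hi; simp [hg, hin, flowCapacity]
    all_goals simp [hg, hx, hi, flowCapacity, eq_comm]
    all_goals grind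
  have hnewIn : ∀ t i y, g (.newIn t) (.out i y) =
      if (h t).failed = y then if t.succ = i then
        if FlowVertex.newIn t ∈ U ∧ FlowVertex.out t.succ (h t).failed ∉ U then
          ENNReal.ofReal α else 0 else 0 else 0 := by
    intro t i y
    simp only [hg, flowCapacity]
    grind
  have hrelay : ∀ t e s, g (.relay t e) (.newIn s) =
      if t = s then if FlowVertex.newIn t ∉ U ∧ e ∈ (h t).helperRacks ∧ FlowVertex.relay t e ∈ U
        then ENNReal.ofReal β else 0 else 0 := by
    intro t e s
    simp only [hg, flowCapacity]
    grind
  have hz₁ : ∀ x b, (∀ i y, b ≠ .out i y) → g (.origIn x) b = 0 := by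
    rintro x (_ | _ | _ | ⟨i, y⟩ | _ | _) hb
    case out => exact absurd rfl (hb i y)
    all_goals exact h0 _ _ (.inl rfl)
  have hz₂ : ∀ t b, (∀ i y, b ≠ .out i y) → g (.newIn t) b = 0 := by
    rintro x (_ | _ | _ | ⟨i, y⟩ | _ | _) hb
    case out => exact absurd rfl (hb i y)
    all_goals exact h0 _ _ (.inl rfl)
  have hz₃ : ∀ t e b, (∀ s, b ≠ .newIn s) → g (.relay t e) b = 0 := by
    rintro t e (_ | _ | s | _ | _ | _) hb
    case newIn => exact absurd rfl (hb s)
    all_goals exact h0 _ _ (.inl rfl)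
  rw [hsum, FlowVertex.sum_univ]
  simp only [FlowVertex.sum_univ (g _), hsource, hcollector, hout, Finset.sum_const_zero, zero_add,
    add_zero, horigIn, hnewIn, hrelay]
  simp only [hz₁, hz₂, hz₃, ne_eq, reduceCtorEq, not_false_eq_true, implies_true,
    Finset.sum_const_zero, zero_add, add_zero, Finset.sum_ite_eq, Finset.mem_univ, if_true]
  congr 1
  · rw [← Finset.sum_filter, Finset.sum_const, nsmul_eq_mul]
  · rw [← Finset.sum_add_distrib]
    refine Finset.sum_congr rfl fun t _ => ?_
    by_cases ht : FlowVertex.newIn t ∈ U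
    · simp [ht]
    · simp only [ht, not_false_eq_true, true_and, false_and, if_false, zero_add]
      rw [← Finset.sum_filter, Finset.sum_const, nsmul_eq_mul]
      congr 3
      ext e; simp

end Cut

/-! ### Node costs and surplus numbers -/

/-- The cost of one node in the cut: `a` if the edge to its out-vertex is cut, and otherwise `b` for
each of the `d` helper racks, all but `i` of which lie on the source side. -/
noncomputable def nodeCost (d : ℕ) (a b : ℝ≥0∞) (i : ℕ) : ℝ≥0∞ := min a ((d - i : ℕ) * b)

/-- The total cost of `N` nodes that are repaired with all their local helpers on the collector
side, `m` nodes in each rack, one rack after the other. -/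
noncomputable def extraCost (d m : ℕ) (a b : ℝ≥0∞) (N : ℕ) : ℝ≥0∞ :=
  ∑ j ∈ Finset.range N, nodeCost d a b (j / m)

theorem nodeCost_le_left (d : ℕ) (a b : ℝ≥0∞) (i : ℕ) : nodeCost d a b i ≤ a := min_le_left _ _

theorem extraCost_mono (d m : ℕ) (a b : ℝ≥0∞) : Monotone (extraCost d m a b) := fun _ _ h =>
  Finset.sum_le_sum_of_subset (Finset.range_subset_range.2 h)

theorem extraCost_succ (d m : ℕ) (a b : ℝ≥0∞) (N : ℕ) :
    extraCost d m a b (N + 1) = extraCost d m a b N + nodeCost d a b (N / m) :=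
  Finset.sum_range_succ _ _

/-- Used to trade surplus nodes for core nodes, which cost exactly `a` each. -/
theorem extraCost_add_le (d m : ℕ) (a b : ℝ≥0∞) (N j : ℕ) :
    extraCost d m a b (N + j) ≤ extraCost d m a b N + j * a := by
  induction j with
  | zero => simp
  | succ j ih =>
    rw [← add_assoc, extraCost_succ]
    push_cast
    rw [add_mul, one_mul, ← add_assoc]
    exact add_le_add ih (nodeCost_le_left _ _ _ _)

/-- The number of those among `k` nodes, filling the racks of `u` nodes one after the other, that
are not among the first `l` nodes of their rack. -/
def excessCount (u l k : ℕ) : ℕ := k / u * (u - l) + (k % u - l)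

theorem excessCount_of_le {u l a : ℕ} (hl : l < u) (ha : a ≤ u) : excessCount u l a = a - l := by
  unfold excessCount
  rcases ha.lt_or_eq with h | rfl
  · simp [Nat.div_eq_of_lt h, Nat.mod_eq_of_lt h]
  · simp [Nat.div_self (show 0 < a by omega)]

/-- Packing two groups together wastes fewer free places: if the two remainders overflow a rack, the
overflow starts a new rack, and at most $l$ of its nodes are again exempt. -/
theorem excessCount_add_le {u l : ℕ} (hl : l < u) (x y : ℕ) :
    excessCount u l x + excessCount u l y ≤ excessCount u l (x + y) := by
  unfold excessCount
  have hu : 0 < u := by omega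
  have hx := Nat.mod_lt x hu
  have hy := Nat.mod_lt y hu
  rw [Nat.add_div hu, Nat.add_mod x y]
  generalize x % u = r, y % u = r' at *
  split_ifs with hc
  · rw [Nat.mod_eq_sub_mod hc, Nat.mod_eq_of_lt (by omega)]
    simp only [add_mul, one_mul]
    omega
  · rw [Nat.mod_eq_of_lt (by omega)]
    simp only [add_mul, add_zero]
    omega

theorem excessCount_le {u l : ℕ} (k : ℕ) : excessCount u l k ≤ k := by
  unfold excessCount
  have := Nat.div_add_mod' k u
  have := Nat.mul_le_mul_left (k / u) (Nat.sub_le u l)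
  omega

theorem sum_sub_le_excessCount {ι : Type*} {u l : ℕ} (hl : l < u) (s : Finset ι) (c : ι → ℕ)
    (hc : ∀ i ∈ s, c i ≤ u) : ∑ i ∈ s, (c i - l) ≤ excessCount u l (∑ i ∈ s, c i) := by
  classical
  induction s using Finset.induction_on with
  | empty => simp
  | insert i s hi ih =>
    rw [Finset.sum_insert hi, Finset.sum_insert hi]
    rw [← excessCount_of_le hl (hc i (Finset.mem_insert_self i s))]
    exact (Nat.add_le_add_left (ih fun j hj => hc j (Finset.mem_insert_of_mem hj)) _).trans
      (excessCount_add_le hl _ _)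

/-! ### The potential of a set of nodes -/

section Racks

variable {nbar u : ℕ}

/-- The number of nodes of a set in a given rack. -/
def rackCount (S : Finset (RackNode nbar u)) (e : Fin nbar) : ℕ := (S.filter fun x => x.1 = e).card

/-- The nodes of a set, at most `l` being counted in each rack. -/
def coreCount (l : ℕ) (S : Finset (RackNode nbar u)) : ℕ := ∑ e, min (rackCount S e) l

/-- The nodes of a set, the first `l` of each rack not being counted. -/
def surplusCount (l : ℕ) (S : Finset (RackNode nbar u)) : ℕ := ∑ e, (rackCount S e - l)

theorem rackCount_mono {S S' : Finset (RackNode nbar u)} (h : S ⊆ S') (e : Fin nbar) :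
    rackCount S e ≤ rackCount S' e :=
  Finset.card_le_card (Finset.filter_subset_filter _ h)

theorem rackCount_insert {S : Finset (RackNode nbar u)} {f : RackNode nbar u} (hf : f ∉ S)
    (e : Fin nbar) : rackCount (insert f S) e = rackCount S e + if e = f.1 then 1 else 0 := by
  unfold rackCount
  rw [Finset.filter_insert]
  split_ifs with h h' h'
  · rw [Finset.card_insert_of_notMem (by simp [hf])]
  · exact absurd h.symm h'
  · exact absurd h'.symm h
  · rfl

theorem card_filter_fst_eq (e : Fin nbar) :
    (Finset.univ.filter fun x : RackNode nbar u => x.1 = e).card = u := by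
  have : (Finset.univ.filter fun x : RackNode nbar u => x.1 = e) = {e} ×ˢ Finset.univ := by
    ext ⟨x, y⟩; simp [eq_comm]
  rw [this, Finset.card_product]
  simp

theorem rackCount_le (S : Finset (RackNode nbar u)) (e : Fin nbar) : rackCount S e ≤ u :=
  (rackCount_mono (Finset.subset_univ S) e).trans_eq (card_filter_fst_eq e)

theorem sum_rackCount (S : Finset (RackNode nbar u)) : ∑ e, rackCount S e = S.card :=
  (Finset.card_eq_sum_card_fiberwise (f := Prod.fst) (t := Finset.univ) (by simp)).symm

theorem coreCount_add_surplusCount (l : ℕ) (S : Finset (RackNode nbar u)) :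
    coreCount l S + surplusCount l S = S.card := by
  rw [← sum_rackCount, coreCount, surplusCount, ← Finset.sum_add_distrib]
  exact Finset.sum_congr rfl fun e _ => by omega

theorem coreCount_mono (l : ℕ) : Monotone (coreCount (nbar := nbar) (u := u) l) := fun _ _ h =>
  Finset.sum_le_sum fun e _ => min_le_min_right _ (rackCount_mono h e)

theorem surplusCount_mono (l : ℕ) : Monotone (surplusCount (nbar := nbar) (u := u) l) :=
  fun _ _ h => Finset.sum_le_sum fun e _ => Nat.sub_le_sub_right (rackCount_mono h e) _

theorem surplusCount_le_excessCount {l : ℕ} (hl : l < u) (S : Finset (RackNode nbar u)) :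
    surplusCount l S ≤ excessCount u l S.card := by
  rw [← sum_rackCount]
  exact sum_sub_le_excessCount hl _ _ fun e _ => rackCount_le S e

theorem surplusCount_insert (l : ℕ) {S : Finset (RackNode nbar u)} {f : RackNode nbar u}
    (hf : f ∉ S) :
    surplusCount l (insert f S) = surplusCount l S + if l ≤ rackCount S f.1 then 1 else 0 := by
  have : ∀ e, rackCount (insert f S) e - l =
      (rackCount S e - l) + if e = f.1 then if l ≤ rackCount S f.1 then 1 else 0 else 0 := by
    intro e
    rw [rackCount_insert hf]
    by_cases he : e = f.1
    · subst he; simp only [if_true]; split_ifs <;> omega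
    · simp [he]
  simp [surplusCount, this, Finset.sum_add_distrib]

theorem coreCount_insert (l : ℕ) {S : Finset (RackNode nbar u)} {f : RackNode nbar u}
    (hf : f ∉ S) :
    coreCount l (insert f S) = coreCount l S + if l ≤ rackCount S f.1 then 0 else 1 := by
  have h₁ := coreCount_add_surplusCount l S
  have h₂ := coreCount_add_surplusCount l (insert f S)
  rw [surplusCount_insert l hf, Finset.card_insert_of_notMem hf] at h₂
  split_ifs at h₂ ⊢ <;> omega

theorem card_fullRacks_mul_le {l : ℕ} (S : Finset (RackNode nbar u)) :
    (Finset.univ.filter fun e : Fin nbar => ∀ g, (e, g) ∈ S).card * (u - l) ≤ surplusCount l S := by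
  rw [← smul_eq_mul, ← Finset.sum_const]
  refine (Finset.sum_le_sum fun e he => ?_).trans
    (Finset.sum_le_sum_of_subset (Finset.subset_univ _))
  have : rackCount S e = u := by
    refine (rackCount_le S e).antisymm ?_
    refine (card_filter_fst_eq (u := u) e).symm.trans_le (Finset.card_le_card fun x hx => ?_)
    simp only [Finset.mem_filter, Finset.mem_univ, true_and] at hx he ⊢
    have := he x.2
    rw [← hx] at this
    exact ⟨this, hx⟩
  rw [this]

/-- A lower bound for the cost of a set of nodes on the collector side of a cut. -/
noncomputable def setCost (d l : ℕ) (a b : ℝ≥0∞) (S : Finset (RackNode nbar u)) : ℝ≥0∞ :=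
  coreCount l S * a + extraCost d (u - l) a b (surplusCount l S)

theorem setCost_mono (d l : ℕ) (a b : ℝ≥0∞) : Monotone (setCost (nbar := nbar) (u := u) d l a b) :=
  fun _ _ h => add_le_add (mul_le_mul_left (Nat.cast_le.2 (coreCount_mono l h)) _)
    (extraCost_mono _ _ _ _ (surplusCount_mono l h))

theorem setCost_le_card_mul (d l : ℕ) (a b : ℝ≥0∞) (S : Finset (RackNode nbar u)) :
    setCost d l a b S ≤ S.card * a := by
  have h := extraCost_add_le d (u - l) a b 0 (surplusCount l S)
  rw [zero_add, show extraCost d (u - l) a b 0 = 0 from rfl, zero_add] at h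
  rw [← coreCount_add_surplusCount l S, Nat.cast_add, add_mul]
  exact add_le_add_right h _

theorem setCost_insert_le (d l : ℕ) (a b : ℝ≥0∞) (S : Finset (RackNode nbar u))
    (f : RackNode nbar u) : setCost d l a b (insert f S) ≤ setCost d l a b S + a := by
  by_cases hf : f ∈ S
  · rw [Finset.insert_eq_of_mem hf]; exact le_self_add
  · unfold setCost
    rw [surplusCount_insert l hf, coreCount_insert l hf]
    split_ifs with hc
    · rw [extraCost_succ, add_zero, add_assoc]
      gcongr
      exact nodeCost_le_left _ _ _ _
    · simp only [add_zero, Nat.cast_add, Nat.cast_one, add_mul, one_mul]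
      rw [add_right_comm]

/-- The host rack already has `l` nodes in `S`, so `f` is a surplus node. Each full rack uses up `u
- l` surplus nodes, so the index $i$ of the new term is at least the number of full racks, and at
least $d-i$ helper racks are not full. -/
theorem setCost_insert_le_of_helpers {l : ℕ} (hl : l < u) (a b : ℝ≥0∞)
    {S : Finset (RackNode nbar u)} {f : RackNode nbar u} (hf : l ≤ rackCount S f.1)
    (H : Finset (Fin nbar)) :
    setCost H.card l a b (insert f S) ≤
      setCost H.card l a b S + (H.filter fun e => ¬ ∀ g, (e, g) ∈ S).card * b := by
  by_cases hfS : f ∈ S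
  · rw [Finset.insert_eq_of_mem hfS]; exact le_self_add
  · unfold setCost
    rw [surplusCount_insert l hfS, coreCount_insert l hfS, if_pos hf, if_pos hf, extraCost_succ,
      add_zero, add_assoc]
    gcongr
    refine (min_le_right _ _).trans ?_
    gcongr
    have h₁ : (Finset.univ.filter fun e : Fin nbar => ∀ g, (e, g) ∈ S).card ≤
        surplusCount l S / (u - l) :=
      (Nat.le_div_iff_mul_le (by omega)).2 (card_fullRacks_mul_le S)
    have h₂ := Finset.card_filter_add_card_filter_not (s := H) (fun e => ∀ g, (e, g) ∈ S)
    have h₃ : (H.filter fun e => ∀ g, (e, g) ∈ S).card ≤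
        (Finset.univ.filter fun e : Fin nbar => ∀ g, (e, g) ∈ S).card :=
      Finset.card_le_card (Finset.filter_subset_filter _ (Finset.subset_univ _))
    omega

/-- Rack-by-rack filling has the largest surplus; each surplus node that `S` lacks in comparison is
a core node of `S`, paid at the maximal price `a`. -/
theorem le_setCost {l : ℕ} (hl : l < u) (d : ℕ) (a b : ℝ≥0∞) (S : Finset (RackNode nbar u)) :
    (S.card - excessCount u l S.card : ℕ) * a + extraCost d (u - l) a b (excessCount u l S.card) ≤
      setCost d l a b S := by
  have h₁ := surplusCount_le_excessCount hl S
  have h₂ := coreCount_add_surplusCount l S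
  obtain ⟨j, hj⟩ := Nat.exists_eq_add_of_le h₁
  rw [hj]
  refine (add_le_add_right (extraCost_add_le _ _ _ _ _ _) _).trans ?_
  rw [add_comm (extraCost _ _ _ _ _), ← add_assoc, ← add_mul, ← Nat.cast_add]
  unfold setCost
  have := excessCount_le (u := u) (l := l) S.card
  gcongr
  omega

end Racks

/-! ### Lower bound for every cut -/

theorem Fin.le_add_sum_of_succ_le {T : ℕ} (φ : Fin (T + 1) → ℝ≥0∞) (c : Fin T → ℝ≥0∞)
    (h : ∀ t, φ t.succ ≤ φ t.castSucc + c t) : φ (Fin.last T) ≤ φ 0 + ∑ t, c t := by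
  induction T with
  | zero => simp
  | succ T ih =>
    rw [Fin.sum_univ_castSucc, ← add_assoc]
    refine (h (Fin.last T)).trans (add_le_add_left ?_ _)
    exact ih (fun i => φ i.castSucc) (fun t => c t.castSucc) fun t => by
      simpa using h t.castSucc

theorem setCost_le_flowMinCut {nbar u dbar l T : ℕ} (hl : l < u) (α β : ℝ)
    (h : Fin T → RackRepair nbar u dbar l) (K : Finset (RackNode nbar u)) :
    setCost dbar l (ENNReal.ofReal α) (ENNReal.ofReal β) K ≤ flowMinCut α β h K := by
  classical
  refine le_iInf fun U => le_iInf fun hs => le_iInf fun hc => ?_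
  by_cases hU : ∀ a ∈ U, ∀ b ∉ U, flowCapacity α β h K a b ≠ ⊤
  swap
  · push Not at hU
    obtain ⟨a, ha, b, hb, hab⟩ := hU
    refine le_top.trans_eq (Eq.symm ?_)
    rw [ENNReal.sum_eq_top]
    exact ⟨a, ha, ENNReal.sum_eq_top.2 ⟨b, Finset.mem_compl.2 hb, hab⟩⟩
  have hin : ∀ x, FlowVertex.origIn x ∈ U := fun x => by
    by_contra hx
    exact hU _ hs _ hx rfl
  rw [sum_flowCapacity_eq hU hin]
  set S : Fin (T + 1) → Finset (RackNode nbar u) := fun i =>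
    Finset.univ.filter fun x => FlowVertex.out i x ∉ U with hS
  have hmem : ∀ i x, x ∈ S i ↔ FlowVertex.out i x ∉ U := by simp [hS]
  have hK : K ⊆ S (Fin.last T) := fun x hx => by
    rw [hmem]
    intro hx'
    exact hU _ hx' _ hc (by simp [flowCapacity, hx])
  have hsurvive : ∀ t : Fin T, S t.succ ⊆ insert (h t).failed (S t.castSucc) := by
    intro t x hx
    rw [Finset.mem_insert, or_iff_not_imp_left, hmem]
    intro hne hx'
    refine hU _ hx' _ ((hmem _ _).1 hx) ?_
    exact if_pos ⟨t, rfl, rfl, rfl, hne⟩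
  refine (setCost_mono _ _ _ _ hK).trans
    ((Fin.le_add_sum_of_succ_le (fun i => setCost dbar l _ _ (S i)) _ fun t => ?_).trans
      (add_le_add_left (setCost_le_card_mul _ _ _ _ _) _))
  by_cases hn : FlowVertex.newIn t ∈ U
  · rw [if_pos hn]
    by_cases hf : FlowVertex.out t.succ (h t).failed ∈ U
    · rw [if_neg (not_not.2 hf), add_zero]
      refine setCost_mono _ _ _ _ fun x hx => ?_
      refine (Finset.mem_insert.1 (hsurvive t hx)).resolve_left ?_
      rintro rfl
      exact (hmem _ _).1 hx hf
    · rw [if_pos hf]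
      exact (setCost_mono _ _ _ _ (hsurvive t)).trans (setCost_insert_le _ _ _ _ _ _)
  · rw [if_neg hn]
    refine (setCost_mono _ _ _ _ (hsurvive t)).trans ?_
    -- The edges from the local helpers to the in-vertex have infinite capacity, so all `l` helpers
    -- are on the collector side.
    have hloc : l ≤ rackCount (S t.castSucc) (h t).failed.1 := by
      refine ((Finset.card_map ⟨fun g => ((h t).failed.1, g), fun _ _ => by simp⟩).trans
        (h t).card_localHelpers).symm.trans_le (Finset.card_le_card fun x hx => ?_)
      obtain ⟨g, hg, rfl⟩ := Finset.mem_map.1 hx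
      rw [Finset.mem_filter, hmem]
      exact ⟨fun hx' => hU _ hx' _ hn (if_pos ⟨rfl, rfl, hg⟩), rfl⟩
    have := setCost_insert_le_of_helpers hl (ENNReal.ofReal α) (ENNReal.ofReal β) hloc
      (h t).helperRacks
    rw [(h t).card_helperRacks] at this
    refine this.trans ?_
    gcongr with e he
    -- A relay on the collector side would drag its whole rack there; hence a rack that is not full
    -- pays `β`.
    intro hfull
    by_contra hr
    refine hfull fun g => (hmem _ _).2 fun hx' => hU _ hx' _ hr ?_
    exact if_pos ⟨rfl, rfl, he⟩

/-! ### The extremal sequence of repairs and its cut -/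

/-- The repaired nodes, in the order of `excessCount`, lie among the first `k` nodes. -/
theorem lt_of_lt_excessCount {u l k t : ℕ} (hl : l < u) (ht : t < excessCount u l k) :
    t / (u - l) * u + (l + t % (u - l)) < k := by
  unfold excessCount at ht
  have hk := Nat.div_add_mod' k u
  have hr := Nat.mod_lt k (show 0 < u by omega)
  have htm := Nat.div_add_mod' t (u - l)
  have hts := Nat.mod_lt t (show 0 < u - l by omega)
  generalize t / (u - l) = q, t % (u - l) = s, k / u = p, k % u = r at *
  rcases lt_trichotomy q p with h | rfl | h
  · have := Nat.mul_le_mul_right u (show q + 1 ≤ p from h)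
    rw [add_mul] at this
    omega
  · omega
  · have := Nat.mul_le_mul_right (u - l) (show p + 1 ≤ q from h)
    rw [add_mul] at this
    omega

theorem lt_excessCount {u l k e g : ℕ} (hg : l ≤ g) (hgu : g < u) (hk : e * u + g < k) :
    e * (u - l) + (g - l) < excessCount u l k := by
  unfold excessCount
  have hkd := Nat.div_add_mod' k u
  have hr := Nat.mod_lt k (show 0 < u by omega)
  generalize k / u = p, k % u = r at *
  rcases lt_trichotomy e p with h | rfl | h
  · have := Nat.mul_le_mul_right (u - l) (show e + 1 ≤ p from h)
    rw [add_mul] at this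
    omega
  · omega
  · have := Nat.mul_le_mul_right u (show p + 1 ≤ e from h)
    rw [add_mul] at this
    omega

/-- `H` contains all racks before `e`, or consists only of such racks when there are at least `d` of
them; the truncated `d - e` covers both cases. -/
theorem exists_helperRacks {nbar d : ℕ} (hd : d < nbar) (e : Fin nbar) :
    ∃ H : Finset (Fin nbar), H.card = d ∧ e ∉ H ∧ (H.filter fun e' => ¬ e' < e).card = d - e := by
  rcases le_total (e : ℕ) d with h | h
  · obtain ⟨H, h₁, h₂, h₃⟩ := Finset.exists_subsuperset_card_eq (s := Finset.Iio e) (t := {e}ᶜ)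
      (n := d) (by intro x; simp only [Finset.mem_Iio, Finset.mem_compl, Finset.mem_singleton]
                   exact ne_of_lt) (by simpa using h)
      (by rw [Finset.card_compl, Finset.card_singleton, Fintype.card_fin]; omega)
    refine ⟨H, h₃, fun he => by simpa using h₂ he, ?_⟩
    have h₄ := Finset.card_filter_add_card_filter_not (s := H) (fun e' => e' < e)
    have h₅ : H.filter (fun e' => e' < e) = Finset.Iio e := by
      ext x
      simp only [Finset.mem_filter, Finset.mem_Iio, and_iff_right_iff_imp]
      exact fun hx => h₁ (Finset.mem_Iio.2 hx)
    rw [h₅, Fin.card_Iio] at h₄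
    omega
  · obtain ⟨H, h₁, h₂⟩ := Finset.exists_subset_card_eq (s := Finset.Iio e) (n := d) (by simpa using h)
    refine ⟨H, h₂, fun he => by simpa using h₁ he, ?_⟩
    rw [Nat.sub_eq_zero_of_le h, Finset.card_eq_zero, Finset.filter_eq_empty_iff]
    exact fun x hx => not_not.2 (Finset.mem_Iio.1 (h₁ hx))

section FirstNodes

variable {nbar u : ℕ}

/-- The first `k` nodes, rack by rack. -/
def firstNodes (nbar u k : ℕ) : Finset (RackNode nbar u) :=
  Finset.univ.filter fun x => (x.1 : ℕ) * u + x.2 < k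

theorem card_firstNodes {k : ℕ} (hk : k ≤ nbar * u) : (firstNodes nbar u k).card = k := by
  have : (firstNodes nbar u k).map finProdFinEquiv.toEmbedding =
      Finset.univ.filter fun i : Fin (nbar * u) => (i : ℕ) < k := by
    ext i
    simp only [firstNodes, Finset.mem_map_equiv, Finset.mem_filter, Finset.mem_univ, true_and]
    conv_rhs => rw [← finProdFinEquiv.apply_symm_apply i]
    rw [finProdFinEquiv_apply_val, add_comm, mul_comm u]
  rw [← Finset.card_map finProdFinEquiv.toEmbedding, this, Fin.card_filter_val_lt, min_eq_right hk]

/-- The nodes on the collector side of the cut after `t` repairs: those of the first `k` nodes that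
are among the first `l` nodes of their rack, and the nodes that have been repaired. -/
def sinkNodes (nbar u l k t : ℕ) : Finset (RackNode nbar u) :=
  Finset.univ.filter fun x => (x.2 : ℕ) < l ∧ (x.1 : ℕ) * u + x.2 < k ∨
    l ≤ (x.2 : ℕ) ∧ (x.1 : ℕ) * (u - l) + (x.2 - l) < t

theorem mem_sinkNodes {l k t : ℕ} {x : RackNode nbar u} : x ∈ sinkNodes nbar u l k t ↔
    (x.2 : ℕ) < l ∧ (x.1 : ℕ) * u + x.2 < k ∨
      l ≤ (x.2 : ℕ) ∧ (x.1 : ℕ) * (u - l) + (x.2 - l) < t := by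
  simp [sinkNodes]

theorem rack_lt {l k t : ℕ} (hl : l < u) (hk : k ≤ nbar * u) (ht : t < excessCount u l k) :
    t / (u - l) < nbar := by
  have := lt_of_lt_excessCount hl ht
  exact lt_of_mul_lt_mul_right (show t / (u - l) * u < nbar * u by omega) (Nat.zero_le u)

/-- The node that is repaired in step `t`. -/
def repairedNode {l k t : ℕ} (hl : l < u) (hk : k ≤ nbar * u) (ht : t < excessCount u l k) :
    RackNode nbar u :=
  (⟨t / (u - l), rack_lt hl hk ht⟩, ⟨l + t % (u - l), by
    have := Nat.mod_lt t (show 0 < u - l by omega)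
    omega⟩)

/-- Ensures that no infinite edge of an unchanged node is cut. -/
theorem eq_repairedNode {l k t : ℕ} (hl : l < u) (hk : k ≤ nbar * u) (ht : t < excessCount u l k)
    {x : RackNode nbar u} (hx : x ∈ sinkNodes nbar u l k (t + 1))
    (hx' : x ∉ sinkNodes nbar u l k t) : x = repairedNode hl hk ht := by
  rw [mem_sinkNodes] at hx hx'
  obtain ⟨e, g⟩ := x
  dsimp only at hx hx'
  have hg : l ≤ (g : ℕ) := by omega
  have hgu := g.2
  have heq : t = (e : ℕ) * (u - l) + (g - l) := by omega
  have hlt : (g : ℕ) - l < u - l := by omega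
  have h₁ : t / (u - l) = e := by
    rw [heq, mul_comm, Nat.mul_add_div (by omega), Nat.div_eq_of_lt hlt, add_zero]
  have h₂ : t % (u - l) = g - l := by
    rw [heq, mul_comm, Nat.mul_add_mod, Nat.mod_eq_of_lt hlt]
  refine Prod.ext (Fin.ext h₁.symm) (Fin.ext ?_)
  show (g : ℕ) = l + t % (u - l)
  omega

theorem mem_sinkNodes_of_lt {l k t : ℕ} (hl : l < u) (ht : t < excessCount u l k)
    {e : Fin nbar} (he : (e : ℕ) < t / (u - l)) (g : Fin u) : (e, g) ∈ sinkNodes nbar u l k t := by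
  rw [mem_sinkNodes]
  have hgu := g.2
  have h₀ := lt_of_lt_excessCount hl ht
  rcases lt_or_ge (g : ℕ) l with hg | hg
  · refine .inl ⟨hg, ?_⟩
    have := Nat.mul_le_mul_right u (show (e : ℕ) + 1 ≤ _ from he)
    rw [add_mul] at this
    dsimp only
    omega
  · refine .inr ⟨hg, ?_⟩
    have h₁ := Nat.mul_le_mul_right (u - l) (show (e : ℕ) + 1 ≤ _ from he)
    have h₂ := Nat.div_add_mod' t (u - l)
    rw [add_mul] at h₁
    dsimp only
    omega

theorem card_sinkNodes_zero_le {l k : ℕ} (hl : l < u) (hk : k ≤ nbar * u) :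
    (sinkNodes nbar u l k 0).card ≤ k - excessCount u l k := by
  have h₁ := Finset.card_filter_add_card_filter_not (s := firstNodes nbar u k)
    (fun x => (x.2 : ℕ) < l)
  rw [card_firstNodes hk] at h₁
  have h₂ : (sinkNodes nbar u l k 0).card ≤
      ((firstNodes nbar u k).filter fun x => (x.2 : ℕ) < l).card := by
    refine Finset.card_le_card fun x hx => ?_
    rw [mem_sinkNodes] at hx
    simp only [firstNodes, Finset.mem_filter, Finset.mem_univ, true_and]
    omega
  have h₃ : excessCount u l k ≤
      ((firstNodes nbar u k).filter fun x => ¬ (x.2 : ℕ) < l).card := by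
    rw [← Fintype.card_fin (excessCount u l k), ← Finset.card_univ]
    refine Finset.card_le_card_of_injOn (fun t => repairedNode hl hk t.2) (fun t _ => ?_) ?_
    · simp only [firstNodes, Finset.coe_filter, Finset.mem_filter, Finset.mem_univ, true_and,
        Set.mem_ofPred_eq]
      exact ⟨lt_of_lt_excessCount hl t.2, by simp [repairedNode]⟩
    · intro t _ s _ hts
      simp only [repairedNode, Prod.mk.injEq, Fin.mk.injEq] at hts
      apply Fin.ext
      rw [← Nat.div_add_mod' t (u - l), ← Nat.div_add_mod' s (u - l), hts.1,
        Nat.add_left_cancel hts.2]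
  omega

end FirstNodes

theorem exists_flowMinCut_le {nbar u dbar l k : ℕ} (hl : l < u) (hk : k ≤ nbar * u)
    (hd : dbar < nbar) (α β : ℝ) :
    ∃ h : Fin (excessCount u l k) → RackRepair nbar u dbar l,
      flowMinCut α β h (firstNodes nbar u k) ≤
        (k - excessCount u l k : ℕ) * ENNReal.ofReal α +
          extraCost dbar (u - l) (ENNReal.ofReal α) (ENNReal.ofReal β) (excessCount u l k) := by
  classical
  choose H hHcard hHe hHfilter using fun e : Fin nbar => exists_helperRacks hd e
  let h : Fin (excessCount u l k) → RackRepair nbar u dbar l := fun t =>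
    { failed := repairedNode hl hk t.2
      localHelpers := Finset.univ.filter fun g : Fin u => (g : ℕ) < l
      card_localHelpers := by rw [Fin.card_filter_val_lt, min_eq_right hl.le]
      failed_notMem := by simp [repairedNode]
      helperRacks := H (repairedNode hl hk t.2).1
      card_helperRacks := hHcard _
      host_notMem := hHe _ }
  refine ⟨h, ?_⟩
  set a := ENNReal.ofReal α
  set b := ENNReal.ofReal β
  -- The side of `newIn t` selects the smaller term in `nodeCost`. Relays of earlier racks are on
  -- the collector side, so only the later helpers pay.
  let P : FlowVertex nbar u (excessCount u l k) → Prop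
    | .source => True
    | .origIn _ => True
    | .newIn t => a ≤ (dbar - t / (u - l) : ℕ) * b
    | .out i x => x ∉ sinkNodes nbar u l k i
    | .relay t e => ¬ e < (repairedNode hl hk t.2).1
    | .collector => False
  set U := Finset.univ.filter P with hUdef
  have hmem : ∀ v, v ∈ U ↔ P v := by simp [hUdef]
  have hs : FlowVertex.source ∈ U := (hmem _).2 trivial
  have hin : ∀ x, FlowVertex.origIn x ∈ U := fun x => (hmem _).2 trivial
  have hc : FlowVertex.collector ∉ U := fun h => (hmem _).1 h
  refine (iInf_le_of_le U (iInf_le_of_le hs (iInf_le _ hc))).trans ?_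
  have hite : ∀ (p : Prop) [Decidable p], ¬ p → (if p then (⊤ : ℝ≥0∞) else 0) ≠ ⊤ := by
    intro p _ hp
    simp [hp]
  have hite' : ∀ (p : Prop) [Decidable p] (c : ℝ), (if p then ENNReal.ofReal c else 0) ≠ ⊤ := by
    intro p _ c
    split_ifs <;> simp
  have hU : ∀ v ∈ U, ∀ w ∉ U, flowCapacity α β h (firstNodes nbar u k) v w ≠ ⊤ := by
    intro v hv w hw
    have hout : ∀ i x, FlowVertex.out i x ∈ U → x ∉ sinkNodes nbar u l k i :=
      fun i x hx => (hmem _).1 hx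
    have hout' : ∀ i x, FlowVertex.out i x ∉ U → x ∈ sinkNodes nbar u l k i :=
      fun i x hx => by_contra fun hx' => hx ((hmem _).2 hx')
    cases v <;> cases w
    case source.origIn x => exact absurd (hin x) hw
    case origIn.out => exact hite' _ _
    case newIn.out => exact hite' _ _
    case relay.newIn => exact hite' _ _
    case out.out i x j y =>
      refine hite _ ?_
      rintro ⟨t, rfl, rfl, rfl, hne⟩
      exact hne (eq_repairedNode hl hk t.2 (hout' _ _ hw) (hout _ _ hv))
    case out.newIn i x t =>
      refine hite _ ?_
      rintro ⟨rfl, hx₁, hx₂⟩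
      refine hout _ _ hv (mem_sinkNodes.2 (.inl ?_))
      have hx : (x.2 : ℕ) < l := by simpa [h] using hx₂
      have := lt_of_lt_excessCount hl t.2
      have hx₁' : (x.1 : ℕ) = t / (u - l) := congrArg Fin.val hx₁
      rw [hx₁']
      omega
    case out.relay i x t e =>
      refine hite _ ?_
      rintro ⟨rfl, rfl, -⟩
      have : ¬ ¬ x.1 < (repairedNode hl hk t.2).1 := fun hx => hw ((hmem _).2 hx)
      exact hout _ _ hv (mem_sinkNodes_of_lt hl t.2 (Fin.lt_def.1 (not_not.1 this)) x.2)
    case out.collector i x =>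
      refine hite _ ?_
      rintro ⟨rfl, hx⟩
      refine hout _ _ hv (mem_sinkNodes.2 ?_)
      have hx' : (x.1 : ℕ) * u + x.2 < k := by simpa [firstNodes] using hx
      rcases lt_or_ge (x.2 : ℕ) l with hg | hg
      · exact .inl ⟨hg, hx'⟩
      · exact .inr ⟨hg, lt_excessCount hg x.2.2 hx'⟩
    all_goals exact ENNReal.zero_ne_top
  rw [sum_flowCapacity_eq hU hin]
  refine add_le_add ?_ ?_
  · gcongr
    refine le_trans (Finset.card_le_card fun x hx => ?_) (card_sinkNodes_zero_le hl hk)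
    simp only [Finset.mem_filter, Finset.mem_univ, true_and] at hx
    exact by_contra fun hx' => hx ((hmem _).2 hx')
  · unfold extraCost
    rw [← Fin.sum_univ_eq_sum_range]
    refine Finset.sum_le_sum fun t _ => ?_
    by_cases hn : FlowVertex.newIn t ∈ U
    · rw [if_pos hn, nodeCost, min_eq_left ((hmem _).1 hn)]
      split_ifs <;> simp [a]
    · rw [if_neg hn, nodeCost, min_eq_right (le_of_not_ge fun hx => hn ((hmem _).2 hx))]
      gcongr
      refine (Finset.card_le_card ?_).trans_eq (hHfilter (repairedNode hl hk t.2).1)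
      intro e he
      simp only [Finset.mem_filter] at he ⊢
      exact ⟨he.1, (hmem _).1 he.2⟩

/-! ### Closed form of the capacity -/

theorem extraCost_mul (d m : ℕ) (a b : ℝ≥0∞) (n : ℕ) :
    extraCost d m a b (n * m) = m * ∑ i ∈ Finset.range n, nodeCost d a b i := by
  rcases m.eq_zero_or_pos with rfl | hm
  · simp [extraCost]
  · induction n with
    | zero => simp [extraCost]
    | succ n ih =>
      rw [add_mul, one_mul, Finset.sum_range_succ, mul_add, ← ih]
      unfold extraCost
      rw [Finset.sum_range_add, ← nsmul_eq_mul m, ← Finset.card_range m, ← Finset.sum_const,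
        Finset.card_range]
      congr 1
      refine Finset.sum_congr rfl fun j hj => ?_
      rw [mul_comm, Nat.mul_add_div hm, Nat.div_eq_of_lt (Finset.mem_range.1 hj), add_zero]

/-- From rack `d` on all helpers can be earlier racks, so nodes there cost nothing. Hence the
surplus of the incomplete last rack drops out once $\bar d\le\bar k$. -/
theorem extraCost_mul_add {d q : ℕ} (hq : d ≤ q) {m : ℕ} (hm : 0 < m) (a b : ℝ≥0∞) (s : ℕ) :
    extraCost d m a b (q * m + s) = m * ∑ i ∈ Finset.range d, nodeCost d a b i := by
  have h₀ : ∀ i, d ≤ i → nodeCost d a b i = 0 := fun i hi => by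
    simp [nodeCost, Nat.sub_eq_zero_of_le hi]
  rw [← extraCost_mul]
  refine (Finset.sum_subset (Finset.range_subset_range.2 ?_) fun j _ hj => h₀ _ ?_).symm
  · exact (Nat.mul_le_mul_right m hq).trans (Nat.le_add_right _ _)
  · rw [Finset.mem_range, not_lt] at hj
    exact (Nat.le_div_iff_mul_le hm).2 hj

theorem nodeCost_ofReal (α β : ℝ) (d i : ℕ) :
    nodeCost d (ENNReal.ofReal α) (ENNReal.ofReal β) i =
      ENNReal.ofReal (min α ((d - i : ℕ) * β)) := by
  rw [nodeCost, ENNReal.ofReal_min, ENNReal.ofReal_mul (Nat.cast_nonneg _), ENNReal.ofReal_natCast]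

theorem sub_excessCount {u l : ℕ} (hl : l < u) (k : ℕ) :
    k - excessCount u l k = k / u * l + min (k % u) l := by
  unfold excessCount
  have h₁ := Nat.div_add_mod' k u
  have h₂ : k / u * u = k / u * (u - l) + k / u * l := by
    rw [← mul_add, Nat.sub_add_cancel hl.le]
  omega

/-- The capacity `A α + m ∑ min {α, i β}`, summed over `1 ≤ i ≤ d`. -/
noncomputable def capacity (A m : ℝ) (d : ℕ) (α β : ℝ) : ℝ :=
  A * α + m * ∑ i ∈ Finset.range d, min α ((d - i : ℕ) * β)

theorem capacity_nonneg {A m α β : ℝ} (d : ℕ) (hA : 0 ≤ A) (hm : 0 ≤ m) (hα : 0 ≤ α) (hβ : 0 ≤ β) :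
    0 ≤ capacity A m d α β :=
  add_nonneg (mul_nonneg hA hα) (mul_nonneg hm
    (Finset.sum_nonneg fun _ _ => le_min hα (mul_nonneg (Nat.cast_nonneg _) hβ)))

theorem maxFileSize_eq {nbar u k dbar l : ℕ} (hl : l < u) (hk : k ≤ nbar * u)
    (hd : dbar < k / u) {α β : ℝ} (hα : 0 ≤ α) (hβ : 0 ≤ β) :
    maxFileSize nbar u k dbar l α β =
      ENNReal.ofReal (capacity (k / u * l + min (k % u) l : ℕ) (u - l : ℕ) dbar α β) := by
  have hdn : dbar < nbar := hd.trans_le (Nat.div_le_of_le_mul (by rwa [mul_comm]))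
  have heq : ENNReal.ofReal (capacity (k / u * l + min (k % u) l : ℕ) (u - l : ℕ) dbar α β) =
      (k - excessCount u l k : ℕ) * ENNReal.ofReal α +
        extraCost dbar (u - l) (ENNReal.ofReal α) (ENNReal.ofReal β) (excessCount u l k) := by
    rw [sub_excessCount hl]
    unfold excessCount capacity
    rw [extraCost_mul_add hd.le (by omega), ENNReal.ofReal_add (by positivity)
      (mul_nonneg (Nat.cast_nonneg _) (Finset.sum_nonneg fun _ _ => by positivity)),
      ENNReal.ofReal_mul (Nat.cast_nonneg _), ENNReal.ofReal_mul (Nat.cast_nonneg _),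
      ENNReal.ofReal_natCast, ENNReal.ofReal_natCast,
      ENNReal.ofReal_sum_of_nonneg fun _ _ => by positivity]
    simp only [nodeCost_ofReal]
  rw [heq]
  refine le_antisymm ?_ ?_
  · obtain ⟨h, hh⟩ := exists_flowMinCut_le hl hk hdn α β
    unfold maxFileSize
    refine iInf_le_of_le (excessCount u l k) (iInf_le_of_le h ?_)
    exact iInf_le_of_le (firstNodes nbar u k) (iInf_le_of_le (card_firstNodes hk) hh)
  · refine le_iInf fun T => le_iInf fun h => le_iInf fun K => le_iInf fun hK => ?_
    subst hK
    exact (le_setCost hl _ _ _ K).trans (setCost_le_flowMinCut hl α β h K)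

/-- The `l + 1` nodes of one rack hold `(l + 1) α` symbols of information if and only if the
`dbar` helper racks of a repair together upload at least the contents of one node. -/
theorem forall_le_flowMinCut_iff {nbar u dbar l : ℕ} (hl : l < u) (hd : dbar < nbar)
    {α β : ℝ} (hα : 0 ≤ α) (hβ : 0 ≤ β) :
    (∀ (T : ℕ) (h : Fin T → RackRepair nbar u dbar l) (K : Finset (RackNode nbar u))
      (e : Fin nbar), (∀ x ∈ K, x.1 = e) → K.card = l + 1 →
        ENNReal.ofReal (((l : ℝ) + 1) * α) ≤ flowMinCut α β h K) ↔ α ≤ dbar * β := by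
  -- Of `l + 1` nodes filling one rack, `l` are core and exactly one is surplus.
  have hexc : excessCount u l (l + 1) = 1 := by rw [excessCount_of_le hl hl]; omega
  have hcost : ((l + 1 - excessCount u l (l + 1) : ℕ) : ℝ≥0∞) * ENNReal.ofReal α +
      extraCost dbar (u - l) (ENNReal.ofReal α) (ENNReal.ofReal β) (excessCount u l (l + 1)) =
      ENNReal.ofReal (l * α + min α (dbar * β)) := by
    rw [hexc, Nat.add_sub_cancel, extraCost, Finset.sum_range_one, Nat.zero_div,
      nodeCost_ofReal, Nat.sub_zero, ENNReal.ofReal_add (by positivity) (by positivity),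
      ENNReal.ofReal_mul (Nat.cast_nonneg _), ENNReal.ofReal_natCast]
  constructor
  · intro H
    have hk : l + 1 ≤ nbar * u := hl.trans_le (Nat.le_mul_of_pos_left u (by omega))
    obtain ⟨h, hh⟩ := exists_flowMinCut_le hl hk hd α β
    have hrack : ∀ x ∈ firstNodes nbar u (l + 1), x.1 = ⟨0, by omega⟩ := by
      intro x hx
      have hx' : (x.1 : ℕ) * u + x.2 < l + 1 := by simpa [firstNodes] using hx
      refine Fin.ext (Nat.eq_zero_of_not_pos fun hpos => ?_)
      have := Nat.le_mul_of_pos_left u hpos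
      omega
    have h₁ := (H _ h _ _ hrack (card_firstNodes hk)).trans hh
    rw [hcost, ENNReal.ofReal_le_ofReal_iff (by positivity)] at h₁
    have h₂ := min_le_right α (dbar * β)
    linarith
  · intro hle T h K e _ hcard
    refine le_trans (le_of_eq ?_) ((le_setCost hl _ _ _ K).trans (setCost_le_flowMinCut hl α β h K))
    rw [hcard, hcost, min_eq_left hle, add_mul, one_mul]

theorem isMETRRC_iff {nbar u k dbar l : ℕ} (hl : l < u) (hk : k ≤ nbar * u)
    (hd : dbar < k / u) {B : ℝ} (hB : 0 < B) (α β : ℝ) :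
    IsMETRRC nbar u k dbar l B α β ↔ 0 ≤ α ∧ 0 ≤ β ∧
      B = capacity (k / u * l + min (k % u) l : ℕ) (u - l : ℕ) dbar α β ∧
        (0 < dbar → α ≤ dbar * β) := by
  have hdn : dbar < nbar := hd.trans_le (Nat.div_le_of_le_mul (by rwa [mul_comm]))
  unfold IsMETRRC
  refine and_congr_right fun hα => and_congr_right fun hβ => and_congr ?_ ?_
  · rw [maxFileSize_eq hl hk hd hα hβ, ENNReal.ofReal_eq_ofReal_iff hB.le
      (capacity_nonneg _ (Nat.cast_nonneg _) (Nat.cast_nonneg _) hα hβ)]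
  · exact imp_congr_right fun _ => forall_le_flowMinCut_iff hl hdn hα hβ

/-! ### Linear bounds for the capacity and their equality cases -/

section Capacity

variable {A m : ℝ} {d : ℕ}

theorem capacity_le_mul_left (hm : 0 ≤ m) (α β : ℝ) : capacity A m d α β ≤ (A + m * d) * α := by
  have : ∑ i ∈ Finset.range d, min α ((d - i : ℕ) * β) ≤ ∑ _i ∈ Finset.range d, α :=
    Finset.sum_le_sum fun _ _ => min_le_left _ _
  rw [Finset.sum_const, Finset.card_range, nsmul_eq_mul] at this
  have := mul_le_mul_of_nonneg_left this hm
  unfold capacity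
  linarith

theorem capacity_lt_mul_left (hm : 0 < m) (hd : 0 < d) {α β : ℝ} (h : β < α) :
    capacity A m d α β < (A + m * d) * α := by
  have : ∑ i ∈ Finset.range d, min α ((d - i : ℕ) * β) < ∑ _i ∈ Finset.range d, α := by
    refine Finset.sum_lt_sum (fun _ _ => min_le_left _ _)
      -- The last term is `min α β`, the one most sensitive to `β < α`.
      ⟨d - 1, Finset.mem_range.2 (by omega), ?_⟩
    rw [Nat.sub_sub_self hd, Nat.cast_one, one_mul]
    exact (min_le_right _ _).trans_lt h
  rw [Finset.sum_const, Finset.card_range, nsmul_eq_mul] at this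
  have := mul_lt_mul_of_pos_left this hm
  unfold capacity
  linarith

theorem capacity_self {α : ℝ} (hα : 0 ≤ α) : capacity A m d α α = (A + m * d) * α := by
  have : ∑ i ∈ Finset.range d, min α ((d - i : ℕ) * α) = ∑ _i ∈ Finset.range d, α := by
    refine Finset.sum_congr rfl fun i hi => min_eq_left ?_
    refine le_mul_of_one_le_left hα ?_
    exact_mod_cast Nat.sub_pos_of_lt (Finset.mem_range.1 hi)
  rw [capacity, this, Finset.sum_const, Finset.card_range, nsmul_eq_mul]
  ring

theorem sum_range_sub_mul (d : ℕ) (β : ℝ) :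
    ∑ i ∈ Finset.range d, ((d - i : ℕ) : ℝ) * β = d * β * (d + 1) / 2 := by
  rw [← Finset.sum_mul]
  have : ∑ i ∈ Finset.range d, ((d - i : ℕ) : ℝ) = d * (d + 1) / 2 := by
    induction d with
    | zero => simp
    | succ d ih =>
      rw [Finset.sum_range_succ']
      simp only [Nat.add_sub_add_right, ih]
      push_cast
      ring
  rw [this]
  ring

theorem capacity_le_mul_right (hA : 0 ≤ A) (hm : 0 ≤ m) {α β : ℝ} (h : α ≤ d * β) :
    capacity A m d α β ≤ (A + m * (d + 1) / 2) * (d * β) := by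
  have : ∑ i ∈ Finset.range d, min α ((d - i : ℕ) * β) ≤
      ∑ i ∈ Finset.range d, ((d - i : ℕ) : ℝ) * β := Finset.sum_le_sum fun _ _ => min_le_right _ _
  rw [sum_range_sub_mul] at this
  have := mul_le_mul_of_nonneg_left this hm
  have := mul_le_mul_of_nonneg_left h hA
  unfold capacity
  linarith

theorem capacity_lt_mul_right (hA : 0 ≤ A) (hm : 0 < m) (hd : 0 < d) {α β : ℝ} (h : α < d * β) :
    capacity A m d α β < (A + m * (d + 1) / 2) * (d * β) := by
  have : ∑ i ∈ Finset.range d, min α ((d - i : ℕ) * β) <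
      ∑ i ∈ Finset.range d, ((d - i : ℕ) : ℝ) * β :=
    Finset.sum_lt_sum (fun _ _ => min_le_right _ _)
      ⟨0, Finset.mem_range.2 hd, (min_le_left _ _).trans_lt h⟩
  rw [sum_range_sub_mul] at this
  have := mul_lt_mul_of_pos_left this hm
  have := mul_le_mul_of_nonneg_left h.le hA
  unfold capacity
  linarith

theorem capacity_mul_self {β : ℝ} (hβ : 0 ≤ β) :
    capacity A m d (d * β) β = (A + m * (d + 1) / 2) * (d * β) := by
  have : ∑ i ∈ Finset.range d, min (d * β) ((d - i : ℕ) * β) =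
      ∑ i ∈ Finset.range d, ((d - i : ℕ) : ℝ) * β := by
    refine Finset.sum_congr rfl fun i _ => min_eq_right ?_
    gcongr
    exact Nat.sub_le _ _
  rw [capacity, this, sum_range_sub_mul]
  ring

end Capacity

/-! ### The extreme points of the tradeoff curve -/

section Points

variable {nbar u k dbar l : ℕ} {B : ℝ}

theorem isMETMSRR_iff (hl : l < u) (hk : k ≤ nbar * u) (hd : dbar < k / u) (hd0 : 0 < dbar)
    (hB : 0 < B) (α β : ℝ) : IsMETMSRR nbar u k dbar l B α β ↔
      α = B / ((k / u * l + min (k % u) l : ℕ) + (u - l : ℕ) * dbar) ∧ α = β := by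
  unfold IsMETMSRR
  simp only [isMETRRC_iff hl hk hd hB, hd0, true_imp_iff]
  set A : ℝ := ((k / u * l + min (k % u) l : ℕ) : ℝ)
  have hA : 0 ≤ A := Nat.cast_nonneg _
  have hm : (0 : ℝ) < (u - l : ℕ) := by exact_mod_cast Nat.sub_pos_of_lt hl
  set m : ℝ := ((u - l : ℕ) : ℝ)
  have hd1 : (1 : ℝ) ≤ dbar := by exact_mod_cast hd0
  have hC : 0 < A + m * dbar := by positivity
  set α₀ := B / (A + m * dbar) with hα₀
  have hα₀pos : 0 < α₀ := div_pos hB hC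
  have hB₀ : (A + m * dbar) * α₀ = B := mul_div_cancel₀ _ hC.ne'
  have hmin : ∀ α β, B = capacity A m dbar α β → α₀ < α ∨ α₀ = α ∧ α₀ ≤ β := by
    intro α β h
    have hle : α₀ ≤ α := by
      rw [hα₀, div_le_iff₀' hC, h]
      exact capacity_le_mul_left hm.le α β
    refine hle.lt_or_eq.imp id fun heq => ⟨heq, le_of_not_gt fun hlt => ?_⟩
    have := capacity_lt_mul_left (A := A) hm hd0 (heq ▸ hlt)
    rw [← h, ← heq, hB₀] at this
    exact this.false
  have hmem : 0 ≤ α₀ ∧ 0 ≤ α₀ ∧ B = capacity A m dbar α₀ α₀ ∧ α₀ ≤ dbar * α₀ :=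
    ⟨hα₀pos.le, hα₀pos.le, by rw [capacity_self hα₀pos.le, hB₀],
      le_mul_of_one_le_left hα₀pos.le hd1⟩
  constructor
  · rintro ⟨⟨-, -, h, -⟩, hopt⟩
    rcases hmin α β h with h₁ | ⟨h₁, h₂⟩ <;> rcases hopt _ _ hmem with h₃ | ⟨h₃, h₄⟩
    · exact absurd h₁ h₃.not_gt
    · exact absurd h₃ h₁.ne'
    · exact absurd h₁ h₃.ne'
    · exact ⟨h₃, h₃.trans (h₂.antisymm h₄)⟩
  · rintro ⟨rfl, rfl⟩
    exact ⟨hmem, fun α' β' h => hmin α' β' h.2.2.1⟩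

/-- The constraint `α ≤ dbar * β` is what bounds the core part `A * α` by the bandwidth; it becomes
an equality at the optimum. -/
theorem isMETMBRR_iff (hl : l < u) (hk : k ≤ nbar * u) (hd : dbar < k / u) (hd0 : 0 < dbar)
    (hB : 0 < B) (α β : ℝ) : IsMETMBRR nbar u k dbar l B α β ↔
      α = B / ((k / u * l + min (k % u) l : ℕ) + (u - l : ℕ) * ((dbar : ℝ) + 1) / 2) ∧
        α = dbar * β := by
  unfold IsMETMBRR
  simp only [isMETRRC_iff hl hk hd hB, hd0, true_imp_iff]
  set A : ℝ := ((k / u * l + min (k % u) l : ℕ) : ℝ)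
  have hA : 0 ≤ A := Nat.cast_nonneg _
  have hm : (0 : ℝ) < (u - l : ℕ) := by exact_mod_cast Nat.sub_pos_of_lt hl
  set m : ℝ := ((u - l : ℕ) : ℝ)
  have hd1 : (0 : ℝ) < dbar := by exact_mod_cast hd0
  have hC : 0 < A + m * ((dbar : ℝ) + 1) / 2 := by positivity
  set α₀ := B / (A + m * ((dbar : ℝ) + 1) / 2) with hα₀
  have hα₀pos : 0 < α₀ := div_pos hB hC
  have hB₀ : (A + m * ((dbar : ℝ) + 1) / 2) * α₀ = B := mul_div_cancel₀ _ hC.ne'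
  have hmin : ∀ α β, B = capacity A m dbar α β → α ≤ dbar * β →
      α₀ < dbar * β ∨ α₀ = dbar * β ∧ α₀ ≤ α := by
    intro α β h hαβ
    have hle : α₀ ≤ dbar * β := by
      rw [hα₀, div_le_iff₀' hC, h]
      exact capacity_le_mul_right hA hm.le hαβ
    refine hle.lt_or_eq.imp id fun heq => ⟨heq, le_of_not_gt fun hlt => ?_⟩
    have := capacity_lt_mul_right hA hm hd0 (hlt.trans_eq heq)
    rw [← h, ← heq, hB₀] at this
    exact this.false
  have hmem : ∀ β, α₀ = dbar * β →
      0 ≤ α₀ ∧ 0 ≤ β ∧ B = capacity A m dbar α₀ β ∧ α₀ ≤ dbar * β := by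
    intro β h
    have hβ : 0 ≤ β := (pos_of_mul_pos_right (h ▸ hα₀pos) hd1.le).le
    exact ⟨hα₀pos.le, hβ, by rw [h, capacity_mul_self hβ, ← h, hB₀], h.le⟩
  constructor
  · rintro ⟨⟨-, -, h, hαβ⟩, hopt⟩
    have hβ₀ : α₀ = dbar * (α₀ / dbar) := (mul_div_cancel₀ _ hd1.ne').symm
    have h₃ := hopt _ _ (hmem _ hβ₀)
    rw [← hβ₀] at h₃
    rcases hmin α β h hαβ with h₁ | ⟨h₁, h₂⟩ <;> rcases h₃ with h₃ | ⟨h₃, h₄⟩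
    · exact absurd h₁ h₃.not_gt
    · exact absurd h₃ h₁.ne'
    · exact absurd h₁ h₃.ne'
    · exact ⟨h₄.antisymm h₂, (h₄.antisymm h₂).trans h₁⟩
  · rintro ⟨rfl, h⟩
    refine ⟨hmem β h, fun α' β' h' => ?_⟩
    rw [← h]
    exact hmin α' β' h'.2.2.1 h'.2.2.2

theorem isMETMSRR_iff_of_local (hl : l < u) (hk : k ≤ nbar * u) (hd : 0 < k / u) (hl0 : 1 ≤ l)
    (hB : 0 < B) (α β : ℝ) : IsMETMSRR nbar u k 0 l B α β ↔
      α = B / (k / u * l + min (k % u) l : ℕ) ∧ β = 0 := by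
  unfold IsMETMSRR
  simp only [isMETRRC_iff hl hk hd hB, capacity, Finset.range_zero, Finset.sum_empty, mul_zero,
    add_zero, lt_irrefl, false_imp_iff, and_true]
  have hA : (0 : ℝ) < (k / u * l + min (k % u) l : ℕ) := by
    exact_mod_cast Nat.add_pos_left (Nat.mul_pos hd hl0) _
  set A : ℝ := ((k / u * l + min (k % u) l : ℕ) : ℝ)
  have hiff : ∀ α, B = A * α ↔ α = B / A := fun α => by
    rw [eq_div_iff hA.ne', mul_comm α, eq_comm]
  simp only [hiff]
  constructor
  · rintro ⟨⟨hα, hβ, h⟩, hopt⟩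
    -- Without helper racks the capacity does not depend on `β`, so `(α, 0)` is a competitor.
    rcases hopt α 0 ⟨hα, le_rfl, h⟩ with h₁ | ⟨-, h₁⟩
    · exact absurd h₁ (lt_irrefl _)
    · exact ⟨h, h₁.antisymm hβ⟩
  · rintro ⟨rfl, rfl⟩
    exact ⟨⟨(div_pos hB hA).le, le_rfl, rfl⟩, fun α' β' h => .inr ⟨h.2.2.symm, h.2.1⟩⟩

end Points

theorem corollary2 (nbar u k dbar l kbar u₀ : ℕ) (hl : l < u) (hk : k ≤ nbar * u)
    (hkbar : kbar = k / u) (hu₀ : u₀ = k - kbar * u) (hdbar : dbar < kbar)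
    (B : ℝ) (hB : 0 < B) :
    (0 < dbar → ∀ α β : ℝ,
      (IsMETMSRR nbar u k dbar l B α β ↔
        α = B / (kbar * l + (min u₀ l : ℕ) + ((u : ℝ) - l) * dbar) ∧ α = β) ∧
      (IsMETMBRR nbar u k dbar l B α β ↔
        α = B / (kbar * l + (min u₀ l : ℕ) + ((u : ℝ) - l) * ((dbar : ℝ) + 1) / 2) ∧
          α = dbar * β)) ∧
    (dbar = 0 → 1 ≤ l → ∀ α β : ℝ,
      (IsMETMSRR nbar u k dbar l B α β ↔
        α = B / (kbar * l + (min u₀ l : ℕ)) ∧ β = 0)) := by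
  subst hkbar
  have hu₀' : u₀ = k % u := by rw [hu₀, ← Nat.mod_eq_sub_div_mul]
  subst hu₀'
  have h₁ : ((k / u * l + min (k % u) l : ℕ) : ℝ) = (k / u : ℕ) * l + (min (k % u) l : ℕ) := by
    push_cast
    rfl
  have h₂ : ((u - l : ℕ) : ℝ) = u - l := Nat.cast_sub hl.le
  refine ⟨fun hd α β => ⟨?_, ?_⟩, ?_⟩
  · rw [isMETMSRR_iff hl hk hdbar hd hB, h₁, h₂]
  · rw [isMETMBRR_iff hl hk hdbar hd hB, h₁, h₂]
  · rintro rfl hl0 α β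
    rw [isMETMSRR_iff_of_local hl hk hdbar hl0 hB, h₁]
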